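/- Let $D$ be an integral domain with quotient field $K$. For nonzero $D$-submodules $A,B$ of $K$ put $(A:B)=\{x\in K: xB\subseteq A\}$ and $B^{-1}=(D:B)$. A semistar operation on $D$ is a map $E\mapsto E^\star$ from the set of nonzero $D$-submodules of $K$ to itself such that, for all $0\neq x\in K$ and all $E,F$: $(xE)^\star=xE^\star$; $E\subseteq F$ implies $E^\star\subseteq F^\star$; $E\subseteq E^\star$ and $(E^\star)^\star=E^\star$. The semistar operation $\star_f$ is defined by letting $E^{\star_f}$ be the union of the $F^\star$ with $F\subseteq E$ nonzero and finitely generated. The domain $D$ is a P$\star$MD if $(FF^{-1})^{\star_f}=D^{\star_f}$ for every nonzero finitely generated $D$-submodule $F$ of $K$. A quasi-$\star_f$-maximal ideal is a maximal element of the set of proper nonzero ideals $I$ of $D$ with $I=I^{\star_f}\cap D$; such an ideal is prime. A nonzero ideal $I$ is $\star_f$-idempotent if $I^{\star_f}=(I^2)^{\star_f}$. A prime ideal $P$ is branched if there is a $P$-primary ideal different from $P$. A prime $P\neq 0$ with $P=P^{\star_f}\cap D$ is $\star_f$-sharp if $\bigcap\{D_M : M \text{ quasi-}\star_f\text{-maximal},\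 M\nsupseteq P\}\nsubseteq D_P$ (an empty intersection being $K$). (1) Let $\star$ be a semistar operation on $D$, and assume that $D$ is a P$\star$MD such that $I$ is $\star_f$-idempotent whenever $I$ is a nonzero ideal of $D$ with $(D^\star:I)=D^\star$. Then each branched quasi-$\star_f$-maximal ideal of $D$ is $\star_f$-sharp. (2) Let $v$ be the operation $E^v=(E^{-1})^{-1}$ and $t=v_f$. Suppose that $D$ is a P$v$MD (that is, $(FF^{-1})^t=D$ for every nonzero finitely generated $D$-submodule $F$ of $K$) in which $I$ is $t$-idempotent (that is, $I^t=(I^2)^t$) whenever $I$ is a nonzero ideal of $D$ with $I^{-1}=D$. Then each branched maximal $t$-ideal $M$ of $D$ (that is, each branched maximal element of the set of proper nonzero ideals $I$ with $I^t=I$) is $t$-sharp, i.e. $\bigcap\{D_N : N \text{ a maximal } t\text{-ideal},\ N\nsupseteq M\}\nsubseteq D_M$. -/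

import Mathlib

open scoped Pointwise
open IsLocalization (coeSubmodule)

/-- A semistar operation on a domain `D` with quotient field `K`: a map `E ↦ E^⋆` on the nonzero
`D`-submodules of `K` with `(xE)^⋆ = xE^⋆` for `x ≠ 0`, monotone, extensive and idempotent.
It is recorded as a map on all `D`-submodules, where the value at the zero submodule, which plays
no role, is normalized to be zero (so each semistar operation corresponds to exactly one term). -/
structure SemistarOperation (D K : Type*) [CommRing D] [IsDomain D] [Field K] [Algebra D K]
    [IsFractionRing D K] where
  toFun : Submodule D K → Submodule D K
  map_bot' : toFun ⊥ = ⊥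
  map_smul' : ∀ (x : K) (E : Submodule D K), x ≠ 0 → toFun (x • E) = x • toFun E
  mono' : ∀ E F : Submodule D K, E ≤ F → toFun E ≤ toFun F
  le_self' : ∀ E : Submodule D K, E ≤ toFun E
  idem' : ∀ E : Submodule D K, toFun (toFun E) = toFun E

namespace SemistarOperation

variable {D K : Type*} [CommRing D] [IsDomain D] [Field K] [Algebra D K] [IsFractionRing D K]

instance : CoeFun (SemistarOperation D K) (fun _ => Submodule D K → Submodule D K) :=
  ⟨SemistarOperation.toFun⟩

/-- The underlying map of `⋆_f`: the union of the `F^⋆`, where `F` ranges over the finitely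
generated submodules of `E` (the term `F = 0` contributes only the element `0`). -/
def finiteTypeFun (σ : SemistarOperation D K) (E : Submodule D K) : Submodule D K where
  carrier := {x | ∃ F : Submodule D K, F.FG ∧ F ≤ E ∧ x ∈ σ F}
  zero_mem' := ⟨⊥, Submodule.fg_bot, bot_le, Submodule.zero_mem _⟩
  add_mem' := by
    rintro x y ⟨F, hF, hFE, hx⟩ ⟨G, hG, hGE, hy⟩
    exact ⟨F ⊔ G, hF.sup hG, sup_le hFE hGE,
      Submodule.add_mem _ (σ.mono' _ _ le_sup_left hx) (σ.mono' _ _ le_sup_right hy)⟩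
  smul_mem' := by
    rintro d x ⟨F, hF, hFE, hx⟩
    exact ⟨F, hF, hFE, Submodule.smul_mem _ d hx⟩

theorem finiteTypeFun_smul_le (σ : SemistarOperation D K) (x : K) (E : Submodule D K)
    (hx : x ≠ 0) : x • σ.finiteTypeFun E ≤ σ.finiteTypeFun (x • E) := by
  intro y hy
  obtain ⟨z, ⟨F, hF, hFE, hz⟩, rfl⟩ := hy
  refine ⟨x • F, hF.map _, Submodule.map_mono hFE, ?_⟩
  rw [σ.map_smul' x F hx]
  exact Submodule.smul_mem_pointwise_smul z x _ hz

/-- The finite-type semistar operation `⋆_f` associated with `⋆`. -/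
def finiteType (σ : SemistarOperation D K) : SemistarOperation D K where
  toFun := σ.finiteTypeFun
  map_bot' := by
    rw [eq_bot_iff]
    rintro x ⟨F, -, hF, hx⟩
    rw [le_bot_iff.mp hF, σ.map_bot'] at hx
    exact hx
  map_smul' := by
    intro x E hx
    refine le_antisymm ?_ (σ.finiteTypeFun_smul_le x E hx)
    have h := Submodule.map_mono (f := DistribSMul.toLinearMap D K x)
      (σ.finiteTypeFun_smul_le x⁻¹ (x • E) (inv_ne_zero hx))
    change x • (x⁻¹ • σ.finiteTypeFun (x • E)) ≤ x • σ.finiteTypeFun (x⁻¹ • (x • E)) at h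
    rwa [smul_smul, smul_smul, mul_inv_cancel₀ hx, inv_mul_cancel₀ hx, one_smul, one_smul] at h
  mono' := by
    rintro E F hEF x ⟨G, hG, hGE, hx⟩
    exact ⟨G, hG, hGE.trans hEF, hx⟩
  le_self' := by
    intro E x hx
    exact ⟨Submodule.span D {x}, Submodule.fg_span_singleton x,
      (Submodule.span_singleton_le_iff_mem x E).mpr hx,
      σ.le_self' _ (Submodule.mem_span_singleton_self x)⟩
  idem' := by
    intro E
    have key : ∀ F : Submodule D K, F.FG → F ≤ σ.finiteTypeFun E →
        ∃ G : Submodule D K, G.FG ∧ G ≤ E ∧ F ≤ σ G := by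
      intro F hF
      induction F, hF using Submodule.fg_induction with
      | singleton x =>
        intro h
        obtain ⟨G, hG, hGE, hx⟩ := h (Submodule.mem_span_singleton_self x)
        exact ⟨G, hG, hGE, (Submodule.span_singleton_le_iff_mem x _).mpr hx⟩
      | sup F₁ F₂ _ _ h₁ h₂ =>
        intro h
        obtain ⟨G₁, hG₁, hE₁, hF₁⟩ := h₁ (le_sup_left.trans h)
        obtain ⟨G₂, hG₂, hE₂, hF₂⟩ := h₂ (le_sup_right.trans h)
        exact ⟨G₁ ⊔ G₂, hG₁.sup hG₂, sup_le hE₁ hE₂,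
          sup_le (hF₁.trans (σ.mono' _ _ le_sup_left)) (hF₂.trans (σ.mono' _ _ le_sup_right))⟩
    refine le_antisymm ?_ ?_
    · rintro x ⟨F, hF, hFE, hx⟩
      obtain ⟨G, hG, hGE, hFG⟩ := key F hF hFE
      refine ⟨G, hG, hGE, ?_⟩
      rw [← σ.idem' G]
      exact σ.mono' _ _ hFG hx
    · intro x hx
      exact ⟨Submodule.span D {x}, Submodule.fg_span_singleton x,
        (Submodule.span_singleton_le_iff_mem x _).mpr hx,
        σ.le_self' _ (Submodule.mem_span_singleton_self x)⟩

/-- A quasi-`⋆`-ideal: a nonzero ideal `I` of `D` with `I^⋆ ∩ D = I`. -/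
def IsQuasiIdeal (σ : SemistarOperation D K) (I : Ideal D) : Prop :=
  I ≠ ⊥ ∧ (σ (coeSubmodule K I)).comap (Algebra.linearMap D K) = I

/-- A quasi-`⋆`-maximal ideal: a maximal element of the set of proper quasi-`⋆`-ideals. -/
def IsQuasiMaximal (σ : SemistarOperation D K) (M : Ideal D) : Prop :=
  Maximal (fun J : Ideal D => σ.IsQuasiIdeal J ∧ J ≠ ⊤) M

theorem IsQuasiMaximal.isPrime {σ : SemistarOperation D K} {P : Ideal D}
    (hP : σ.IsQuasiMaximal P) : P.IsPrime := by
  refine ⟨hP.prop.2, ?_⟩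
  intro a b hab
  by_contra hcon
  rw [not_or] at hcon
  obtain ⟨ha, hb⟩ := hcon
  have hb0 : algebraMap D K b ≠ 0 := by
    intro h
    have h0 : b = 0 := (map_eq_zero_iff _ (IsFractionRing.injective D K)).mp h
    exact hb (h0 ▸ P.zero_mem)
  set Q : Ideal D := P ⊔ Ideal.span {a} with hQ
  set J : Ideal D := (σ (coeSubmodule K Q)).comap (Algebra.linearMap D K) with hJ
  have hQJ : Q ≤ J := fun x hx =>
    σ.le_self' _ ((IsLocalization.mem_coeSubmodule K Q).mpr ⟨x, hx, rfl⟩)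
  have hPJ : P ≤ J := le_sup_left.trans hQJ
  have hJs : coeSubmodule K J ≤ σ (coeSubmodule K Q) := by
    intro x hx
    obtain ⟨y, hy, rfl⟩ := (IsLocalization.mem_coeSubmodule K J).mp hx
    exact hy
  have hJq : σ.IsQuasiIdeal J := by
    refine ⟨fun h => hP.prop.1.1 (le_bot_iff.mp (h ▸ hPJ)), le_antisymm ?_ ?_⟩
    · intro x hx
      have := σ.mono' _ _ hJs hx
      rw [σ.idem'] at this
      exact this
    · intro x hx
      exact σ.le_self' _ ((IsLocalization.mem_coeSubmodule K J).mpr ⟨x, hx, rfl⟩)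
  have haJ : a ∈ J := hQJ ((le_sup_right : Ideal.span {a} ≤ Q) (Ideal.mem_span_singleton_self a))
  have hJtop : J = ⊤ := by
    by_contra hne
    exact ha (hP.le_of_ge ⟨hJq, hne⟩ hPJ haJ)
  have h1 : algebraMap D K 1 ∈ σ (coeSubmodule K Q) := by
    have : (1 : D) ∈ J := hJtop ▸ Submodule.mem_top
    exact this
  have h2 : algebraMap D K b • coeSubmodule K Q ≤ coeSubmodule K P := by
    rintro _ ⟨y, hy, rfl⟩
    obtain ⟨q, hq, rfl⟩ := (IsLocalization.mem_coeSubmodule K Q).mp hy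
    refine (IsLocalization.mem_coeSubmodule K P).mpr ⟨b * q, ?_, ?_⟩
    · obtain ⟨p, hp, c, hc, rfl⟩ := Submodule.mem_sup.mp hq
      obtain ⟨d, rfl⟩ := Ideal.mem_span_singleton'.mp hc
      have e : b * (p + d * a) = b * p + d * (a * b) := by ring
      rw [e]
      exact P.add_mem (P.mul_mem_left _ hp) (P.mul_mem_left _ hab)
    · rw [map_mul]
      rfl
  have h3 : algebraMap D K b • algebraMap D K 1 ∈ σ (coeSubmodule K P) := by
    apply σ.mono' _ _ h2
    rw [σ.map_smul' _ _ hb0]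
    exact Submodule.smul_mem_pointwise_smul _ _ _ h1
  rw [map_one, smul_eq_mul, mul_one] at h3
  have h4 : b ∈ (σ (coeSubmodule K P)).comap (Algebra.linearMap D K) := h3
  rw [hP.prop.1.2] at h4
  exact hb h4

variable (K) in
/-- The localization `D_P` of `D` at a prime ideal `P`, as a subring of `K`. -/
noncomputable def locAt (P : Ideal D) (hP : P.IsPrime) : Subalgebra D K :=
  Localization.subalgebra.ofField K P.primeCompl P.primeCompl_le_nonZeroDivisors

/-- `Θ^⋆(P)`: the intersection of the localizations `D_M`, where `M` ranges over the
quasi-`⋆`-maximal ideals of `D` not containing `P` (it is `K` if there are none). -/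
noncomputable def theta (σ : SemistarOperation D K) (P : Ideal D) : Subalgebra D K :=
  ⨅ (M : Ideal D) (hM : σ.IsQuasiMaximal M) (_ : ¬ P ≤ M), locAt K M hM.isPrime

/-- A prime ideal `P` is `⋆`-sharp if `Θ^⋆(P) ⊈ D_P`. -/
def IsSharp (σ : SemistarOperation D K) (P : Ideal D) (hP : P.IsPrime) : Prop :=
  ¬ σ.theta P ≤ locAt K P hP

/-- `E` is `⋆`-idempotent if `E^⋆ = (E²)^⋆`. -/
def IsIdempotent (σ : SemistarOperation D K) (E : Submodule D K) : Prop :=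
  σ E = σ (E ^ 2)

/-- `D` is a Prüfer `⋆`-multiplication domain: `(F F⁻¹)^{⋆_f} = D^{⋆_f}` for every nonzero finitely
generated `D`-submodule `F` of `K`, where `F⁻¹ = (D : F)`. -/
def IsPSMD (σ : SemistarOperation D K) : Prop :=
  ∀ F : Submodule D K, F.FG → F ≠ ⊥ → σ.finiteType (F * (1 / F)) = σ.finiteType 1

variable (D K) in
open Classical in
/-- The `v`-operation `E ↦ E^v = (E⁻¹)⁻¹`, with `E⁻¹ = (D : E)`. -/
noncomputable def vOp : SemistarOperation D K where
  toFun E := if E = ⊥ then ⊥ else 1 / (1 / E)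
  map_bot' := if_pos rfl
  map_smul' := by
    have hinv : ∀ (x : K) (E : Submodule D K), x ≠ 0 → 1 / (x • E) = x⁻¹ • (1 / E) := by
      intro x E hx
      ext y
      rw [Submodule.mem_div_iff_forall_mul_mem]
      constructor
      · intro h
        have h' : x * y ∈ 1 / E := by
          rw [Submodule.mem_div_iff_forall_mul_mem]
          intro z hz
          have := h (x • z) (Submodule.smul_mem_pointwise_smul z x E hz)
          rwa [smul_eq_mul, mul_left_comm, ← mul_assoc] at this
        have := Submodule.smul_mem_pointwise_smul _ x⁻¹ _ h'
        rwa [smul_eq_mul, inv_mul_cancel_left₀ hx] at this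
      · rintro ⟨z, hz, rfl⟩ _ ⟨w, hw, rfl⟩
        have := (Submodule.mem_div_iff_forall_mul_mem.mp hz) w hw
        change (x⁻¹ * z) * (x * w) ∈ (1 : Submodule D K)
        have e : (x⁻¹ * z) * (x * w) = z * w := by field_simp
        rwa [e]
    intro x E hx
    have hbot : x • E = ⊥ ↔ E = ⊥ := by
      constructor
      · intro h
        rw [← one_smul K E, ← inv_mul_cancel₀ hx, ← smul_smul, h]
        exact Submodule.map_bot _
      · rintro rfl
        exact Submodule.map_bot _
    by_cases hE : E = ⊥
    · rw [if_pos (hbot.mpr hE), if_pos hE]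
      exact (Submodule.map_bot _).symm
    · rw [if_neg (fun h => hE (hbot.mp h)), if_neg hE, hinv x E hx,
        hinv x⁻¹ _ (inv_ne_zero hx), inv_inv]
  mono' := by
    intro E F hEF
    by_cases hE : E = ⊥
    · rw [if_pos hE]
      exact bot_le
    · have hF : F ≠ ⊥ := fun h => hE (le_bot_iff.mp (h ▸ hEF))
      rw [if_neg hE, if_neg hF]
      intro x hx
      rw [Submodule.mem_div_iff_forall_mul_mem] at hx ⊢
      intro y hy
      apply hx y
      rw [Submodule.mem_div_iff_forall_mul_mem] at hy ⊢
      exact fun z hz => hy z (hEF hz)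
  le_self' := by
    intro E
    by_cases hE : E = ⊥
    · rw [if_pos hE, hE]
    · rw [if_neg hE]
      intro x hx
      rw [Submodule.mem_div_iff_forall_mul_mem]
      intro y hy
      rw [mul_comm]
      exact (Submodule.mem_div_iff_forall_mul_mem.mp hy) x hx
  idem' := by
    intro E
    by_cases hE : E = ⊥
    · simp only [if_pos hE, if_true]
    · have hle : ∀ G : Submodule D K, G ≤ 1 / (1 / G) := by
        intro G x hx
        rw [Submodule.mem_div_iff_forall_mul_mem]
        intro y hy
        rw [mul_comm]
        exact (Submodule.mem_div_iff_forall_mul_mem.mp hy) x hx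
      have hE' : (1 / (1 / E) : Submodule D K) ≠ ⊥ := fun h => hE (le_bot_iff.mp (h ▸ hle E))
      rw [if_neg hE, if_neg hE']
      refine le_antisymm ?_ (hle _)
      intro x hx
      rw [Submodule.mem_div_iff_forall_mul_mem] at hx ⊢
      exact fun y hy => hx y (hle _ hy)

variable (D K) in
/-- The `t`-operation `t = v_f`. -/
noncomputable def tOp : SemistarOperation D K := (vOp D K).finiteType

variable (D K) in
/-- `D` is a P`v`MD: every nonzero finitely generated `F` is `t`-invertible,
`(F F⁻¹)^t = D`. -/
def IsPvMD : Prop :=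
  ∀ F : Submodule D K, F.FG → F ≠ ⊥ → tOp D K (F * (1 / F)) = 1

variable (K) in
/-- A `t`-ideal: a nonzero ideal `I` of `D` with `I^t = I`. -/
def IsTIdeal (I : Ideal D) : Prop :=
  I ≠ ⊥ ∧ tOp D K (coeSubmodule K I) = coeSubmodule K I

variable (K) in
/-- A maximal `t`-ideal: a maximal element of the set of proper `t`-ideals. -/
def IsMaximalTIdeal (M : Ideal D) : Prop :=
  Maximal (fun J : Ideal D => IsTIdeal K J ∧ J ≠ ⊤) M

theorem tOp_one_le : tOp D K 1 ≤ 1 := by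
  rintro x ⟨F, -, hF, hx⟩
  have h : x ∈ vOp D K 1 := (vOp D K).mono' _ _ hF hx
  change x ∈ (if (1 : Submodule D K) = ⊥ then ⊥ else 1 / (1 / 1)) at h
  split_ifs at h with h1
  · rw [h1]
    exact h
  · have h2 := (Submodule.mem_div_iff_forall_mul_mem.mp h) 1
      (Submodule.one_mem_div.mpr le_rfl)
    rwa [mul_one] at h2

theorem isTIdeal_iff (I : Ideal D) : IsTIdeal K I ↔ (tOp D K).IsQuasiIdeal I := by
  refine and_congr_right fun _ => ?_
  constructor
  · intro h
    rw [h]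
    exact Submodule.comap_map_eq_of_injective (IsFractionRing.injective D K) I
  · intro h
    refine le_antisymm ?_ ((tOp D K).le_self' _)
    intro x hx
    have hx1 : x ∈ (1 : Submodule D K) := by
      apply tOp_one_le
      refine (tOp D K).mono' _ _ ?_ hx
      rw [← IsLocalization.coeSubmodule_top]
      exact IsLocalization.coeSubmodule_mono K le_top
    obtain ⟨d, rfl⟩ := Submodule.mem_one.mp hx1
    refine (IsLocalization.mem_coeSubmodule K I).mpr ⟨d, ?_, rfl⟩
    rw [← h]
    exact hx

theorem isMaximalTIdeal_iff (M : Ideal D) :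
    IsMaximalTIdeal K M ↔ (tOp D K).IsQuasiMaximal M := by
  unfold IsMaximalTIdeal IsQuasiMaximal
  simp only [isTIdeal_iff]

theorem IsMaximalTIdeal.isPrime {M : Ideal D} (hM : IsMaximalTIdeal K M) : M.IsPrime :=
  ((isMaximalTIdeal_iff M).mp hM).isPrime

end SemistarOperation

/-- A prime ideal `P` is branched if there is a `P`-primary ideal distinct from `P`. -/
def Ideal.IsBranched {R : Type*} [CommRing R] (P : Ideal R) : Prop :=
  ∃ Q : Ideal R, Q.IsPrimary ∧ Q.radical = P ∧ Q ≠ P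

namespace SemistarOperation

/-! Let `Q` be `M`-primary with `Q ≠ M`, pick `a ∈ M \ Q` and put `I = aD_M ∩ D`. In a P`⋆`MD the
ring `D_M` is a valuation domain (`IsPSMD.dvd_or_dvd`), so `Q ⊆ I`. If `M` were not sharp, then
`(D^⋆ : I) = D^⋆`. Indeed, let `xI ⊆ D^⋆`. A quasi-maximal `N ≠ M` does not contain `Q`, and
inverting some `q ∈ Q \ N` gives `x ∈ D_N`. Hence `x ∈ Θ(M) ⊆ D_M`, and `⋂ D_N ⊆ D^⋆`
(`mem_one_of_forall_mem_locAt`) gives `x ∈ D^⋆`. The hypothesis then makes `I` idempotent. But `I`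
is never idempotent (`not_isIdempotent_contraction`): `I` is locally `aD_M` and `I²` is locally
inside `a²D_M`, so idempotence would put some `s ∉ M` into `aD^⋆ ∩ D ⊆ M`. Part (2) is part (1) for
`⋆ = v`, since `D^v = D`. -/

/-- The contraction `aD_P ∩ D` of a principal ideal of `D_P`. -/
def contraction {R : Type*} [CommRing R] (P : Ideal R) (hP : P.IsPrime) (a : R) : Ideal R where
  carrier := {x | ∃ s, s ∉ P ∧ a ∣ s * x}
  zero_mem' := ⟨1, (Ideal.ne_top_iff_one P).mp hP.ne_top, by simp⟩
  add_mem' := by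
    rintro x y ⟨s, hs, hx⟩ ⟨t, ht, hy⟩
    refine ⟨s * t, hP.mul_notMem hs ht, ?_⟩
    have e : s * t * (x + y) = t * (s * x) + s * (t * y) := by ring
    rw [e]
    exact dvd_add (hx.mul_left _) (hy.mul_left _)
  smul_mem' := by
    rintro d x ⟨s, hs, hx⟩
    exact ⟨s, hs, by rw [smul_eq_mul, mul_left_comm]; exact hx.mul_left _⟩

theorem self_mem_contraction {R : Type*} [CommRing R] (P : Ideal R) (hP : P.IsPrime) (a : R) : a ∈ contraction P hP a :=
  ⟨1, (Ideal.ne_top_iff_one P).mp hP.ne_top, by simp⟩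

theorem common_denominator_add {R A : Type*} [CommRing R] [CommRing A] [Algebra R A]
    {b c d s t : R} {x y : A}
    (hx : algebraMap R A s * x = algebraMap R A (b * c))
    (hy : algebraMap R A t * y = algebraMap R A (b * d)) :
    algebraMap R A (s * t) * (x + y) = algebraMap R A (b * (t * c + s * d)) := by
  have e : b * (t * c + s * d) = t * (b * c) + s * (b * d) := by ring
  rw [e, map_add, map_mul _ t, map_mul _ s (b * d), ← hx, ← hy, map_mul]
  ring

variable {D K : Type*} [CommRing D] [IsDomain D] [Field K] [Algebra D K] [IsFractionRing D K]

/-! ### Localizations and quasi-closures -/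

theorem mem_locAt_iff {P : Ideal D} {hP : P.IsPrime} {x : K} :
    x ∈ locAt K P hP ↔ ∃ s : D, s ∉ P ∧ ∃ d : D, algebraMap D K s * x = algebraMap D K d := by
  have hne : ∀ s : D, s ∉ P → algebraMap D K s ≠ 0 := fun s hs h =>
    hs ((map_eq_zero_iff _ (IsFractionRing.injective D K)).mp h ▸ P.zero_mem)
  constructor
  · rintro ⟨d, s, hs, rfl⟩
    exact ⟨s, hs, d, by rw [mul_left_comm, mul_inv_cancel₀ (hne s hs), mul_one]⟩
  · rintro ⟨s, hs, d, h⟩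
    exact ⟨d, s, hs, by rw [← h, mul_comm, inv_mul_cancel_left₀ (hne s hs)]⟩

theorem finiteType_one (σ : SemistarOperation D K) : σ.finiteType 1 = σ 1 := by
  refine le_antisymm ?_ fun x hx => ⟨1, ?_, le_rfl, hx⟩
  · rintro x ⟨F, -, hF, hx⟩
    exact σ.mono' _ _ hF hx
  · rw [Submodule.one_eq_span]
    exact Submodule.fg_span_singleton 1

/-- The ideal `I^⋆ ∩ D`. -/
def quasiClosure (σ : SemistarOperation D K) (I : Ideal D) : Ideal D :=
  (σ (coeSubmodule K I)).comap (Algebra.linearMap D K)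

theorem mem_quasiClosure (σ : SemistarOperation D K) {I : Ideal D} {x : D} :
    x ∈ σ.quasiClosure I ↔ algebraMap D K x ∈ σ (coeSubmodule K I) := Iff.rfl

theorem le_quasiClosure (σ : SemistarOperation D K) (I : Ideal D) : I ≤ σ.quasiClosure I :=
  fun x hx => σ.le_self' _ ((IsLocalization.mem_coeSubmodule K I).mpr ⟨x, hx, rfl⟩)

theorem quasiClosure_idem (σ : SemistarOperation D K) (I : Ideal D) :
    σ.quasiClosure (σ.quasiClosure I) = σ.quasiClosure I := by
  refine le_antisymm (fun x hx => ?_) (σ.le_quasiClosure _)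
  have h : coeSubmodule K (σ.quasiClosure I) ≤ σ (coeSubmodule K I) := by
    rintro _ ⟨y, hy, rfl⟩
    exact hy
  have := σ.mono' _ _ h hx
  rwa [σ.idem'] at this

/-- Turns the finitely generated submodules that define `⋆_f` into ideals, so that compactness
applies in the lattice of ideals. -/
theorem fg_le_coeSubmodule {I : Ideal D} {F : Submodule D K} (hF : F.FG)
    (h : F ≤ coeSubmodule K I) : ∃ J : Ideal D, J.FG ∧ J ≤ I ∧ coeSubmodule K J = F := by
  have hmap : coeSubmodule K (F.comap (Algebra.linearMap D K)) = F := by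
    refine Submodule.map_comap_eq_self (h.trans ?_)
    rintro _ ⟨y, -, rfl⟩
    exact ⟨y, rfl⟩
  refine ⟨F.comap (Algebra.linearMap D K), ?_, ?_, hmap⟩
  · refine Submodule.fg_of_fg_map_injective (Algebra.linearMap D K)
      (IsFractionRing.injective D K) ?_
    exact (congrArg Submodule.FG hmap).mpr hF
  · intro x hx
    obtain ⟨y, hy, hxy⟩ := h hx
    exact IsFractionRing.injective D K hxy ▸ hy

/-! ### Quasi-maximal ideals -/

/-- Each nonzero ideal whose quasi-closure is proper lies in a quasi-`⋆_f`-maximal ideal. -/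
theorem exists_isQuasiMaximal_ge (σ : SemistarOperation D K) {I : Ideal D} (hI : I ≠ ⊥)
    (h1 : (1 : D) ∉ σ.finiteType.quasiClosure I) :
    ∃ M, σ.finiteType.IsQuasiMaximal M ∧ I ≤ M := by
  have hprop : σ.finiteType.IsQuasiIdeal (σ.finiteType.quasiClosure I) ∧
      σ.finiteType.quasiClosure I ≠ ⊤ :=
    ⟨⟨fun h => hI (le_bot_iff.mp (h ▸ σ.finiteType.le_quasiClosure I)),
      σ.finiteType.quasiClosure_idem I⟩, fun h => h1 (h ▸ Submodule.mem_top)⟩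
  have hchain : ∀ c ⊆ {J : Ideal D | σ.finiteType.IsQuasiIdeal J ∧ J ≠ ⊤}, IsChain (· ≤ ·) c →
      ∀ J ∈ c, ∃ ub ∈ {J : Ideal D | σ.finiteType.IsQuasiIdeal J ∧ J ≠ ⊤}, ∀ L ∈ c, L ≤ ub := by
    intro c hc hchain J hJ
    have hmem : ∀ {x : D}, x ∈ sSup c ↔ ∃ L ∈ c, x ∈ L :=
      Submodule.mem_sSup_of_directed ⟨J, hJ⟩ hchain.directedOn
    refine ⟨sSup c, ⟨⟨fun h => (hc hJ).1.1 (le_bot_iff.mp (h ▸ le_sSup hJ)), ?_⟩, ?_⟩,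
      fun L hL => le_sSup hL⟩
    · refine le_antisymm ?_ (σ.finiteType.le_quasiClosure _)
      -- Finite type is essential here: membership in the closure of the union is witnessed by a
      -- finitely generated ideal, which already lies in one member of the chain.
      rintro x ⟨F, hF, hFc, hx⟩
      obtain ⟨G, hG, hGc, rfl⟩ := fg_le_coeSubmodule hF hFc
      obtain ⟨L, hL, hGL⟩ : ∃ L ∈ c, G ≤ L :=
        (CompleteLattice.isCompactElement_iff_le_of_directed_sSup_le _ G).mp
          ((Submodule.fg_iff_compact G).mp hG) c ⟨J, hJ⟩ hchain.directedOn hGc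
      have hxL : x ∈ σ.finiteType.quasiClosure L :=
        ⟨_, hF, IsLocalization.coeSubmodule_mono K hGL, hx⟩
      have hLq : σ.finiteType.quasiClosure L = L := (hc hL).1.2
      exact hmem.mpr ⟨L, hL, hLq ▸ hxL⟩
    · rw [Ideal.ne_top_iff_one, hmem]
      rintro ⟨L, hL, h⟩
      exact (Ideal.ne_top_iff_one L).mp (hc hL).2 h
  obtain ⟨M, hIM, hM⟩ := zorn_le_nonempty₀ _ hchain _ hprop
  exact ⟨M, hM, (σ.finiteType.le_quasiClosure I).trans hIM⟩

/-- The intersection of the `D_M`, `M` quasi-`⋆_f`-maximal, is contained in `D^⋆`. -/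
theorem mem_one_of_forall_mem_locAt (σ : SemistarOperation D K) {x : K}
    (hx : ∀ (M : Ideal D) (hM : σ.finiteType.IsQuasiMaximal M), x ∈ locAt K M hM.isPrime) :
    x ∈ σ 1 := by
  rcases eq_or_ne x 0 with rfl | hx0
  · exact Submodule.zero_mem _
  -- The ideal of denominators of `x`. It lies in no quasi-maximal ideal, so `1 ∈ J^{⋆_f}`, and
  -- multiplying by `x` gives `x ∈ (xJ)^{⋆_f} ⊆ D^⋆`.
  set J : Ideal D := (1 / Submodule.span D {x} : Submodule D K).comap (Algebra.linearMap D K)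
    with hJ
  have hmem : ∀ {s : D}, s ∈ J ↔ ∃ d : D, algebraMap D K s * x = algebraMap D K d := by
    intro s
    constructor
    · intro hs
      obtain ⟨d, hd⟩ := Submodule.mem_one.mp
        (Submodule.mem_div_iff_forall_mul_mem.mp hs x (Submodule.mem_span_singleton_self x))
      exact ⟨d, hd.symm⟩
    · rintro ⟨d, hd⟩
      refine Submodule.mem_div_iff_forall_mul_mem.mpr fun y hy => ?_
      obtain ⟨r, rfl⟩ := Submodule.mem_span_singleton.mp hy
      rw [mul_smul_comm]
      exact Submodule.smul_mem _ r (Submodule.mem_one.mpr ⟨d, hd.symm⟩)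
  have hJ0 : J ≠ ⊥ := by
    obtain ⟨b, c, hc, rfl⟩ := IsFractionRing.div_surjective (A := D) x
    have hc' : algebraMap D K c ≠ 0 := IsFractionRing.to_map_ne_zero_of_mem_nonZeroDivisors hc
    intro h
    have : c ∈ J := hmem.mpr ⟨b, mul_div_cancel₀ _ hc'⟩
    rw [h] at this
    exact nonZeroDivisors.ne_zero hc this
  have h1 : algebraMap D K 1 ∈ σ.finiteType (coeSubmodule K J) := by
    by_contra h1
    obtain ⟨M, hM, hJM⟩ := σ.exists_isQuasiMaximal_ge hJ0 h1
    obtain ⟨s, hs, hd⟩ := mem_locAt_iff.mp (hx M hM)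
    exact hs (hJM (hmem.mpr hd))
  have hle : x • coeSubmodule K J ≤ 1 := by
    rintro _ ⟨_, ⟨s, hs, rfl⟩, rfl⟩
    obtain ⟨d, hd⟩ := hmem.mp hs
    exact Submodule.mem_one.mpr ⟨d, by rw [← hd, mul_comm]; rfl⟩
  rw [← σ.finiteType_one]
  refine σ.finiteType.mono' _ _ hle ?_
  rw [σ.finiteType.map_smul' _ _ hx0]
  have := Submodule.smul_mem_pointwise_smul _ x _ h1
  rwa [map_one, smul_eq_mul, mul_one] at this

/-- If `a` lies in a quasi-`⋆_f`-maximal ideal `M`, then `aD^⋆ ∩ D ⊆ M`. -/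
theorem IsQuasiMaximal.mem_of_eq_mul {σ : SemistarOperation D K} {M : Ideal D}
    (hM : σ.finiteType.IsQuasiMaximal M) {a s : D} (ha : a ∈ M) {y : K} (hy : y ∈ σ 1)
    (h : algebraMap D K s = algebraMap D K a * y) : s ∈ M := by
  have hMq : σ.finiteType.quasiClosure M = M := hM.prop.1.2
  rcases eq_or_ne a 0 with rfl | ha0
  · rw [map_zero, zero_mul] at h
    rw [(map_eq_zero_iff _ (IsFractionRing.injective D K)).mp h]
    exact M.zero_mem
  have ha' : algebraMap D K a ≠ 0 :=
    fun h => ha0 ((map_eq_zero_iff _ (IsFractionRing.injective D K)).mp h)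
  have hle : algebraMap D K a • (1 : Submodule D K) ≤ coeSubmodule K M := by
    rintro _ ⟨z, hz, rfl⟩
    obtain ⟨d, rfl⟩ := Submodule.mem_one.mp hz
    exact ⟨a * d, M.mul_mem_right d ha, map_mul (algebraMap D K) a d⟩
  rw [← hMq, mem_quasiClosure]
  refine σ.finiteType.mono' _ _ hle ?_
  rw [σ.finiteType.map_smul' _ _ ha', σ.finiteType_one, h]
  exact Submodule.smul_mem_pointwise_smul _ _ _ hy

/-! ### Localizations of a P`⋆`MD are valuation domains containing `D^⋆` -/

/-- If `D` is a P`⋆`MD and `M` is quasi-`⋆_f`-maximal, then `D_M` is a valuation domain. -/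
theorem IsPSMD.dvd_or_dvd {σ : SemistarOperation D K} (h : σ.IsPSMD) {M : Ideal D}
    (hM : σ.finiteType.IsQuasiMaximal M) (a b : D) :
    ∃ s, s ∉ M ∧ (a ∣ s * b ∨ b ∣ s * a) := by
  have h1M : (1 : D) ∉ M := (Ideal.ne_top_iff_one M).mp hM.prop.2
  rcases eq_or_ne a 0 with rfl | ha0
  · exact ⟨1, h1M, Or.inr (by simp)⟩
  by_contra! hcon
  set F : Submodule D K := Submodule.span D {algebraMap D K a, algebraMap D K b} with hF
  have haF : algebraMap D K a ∈ F := Submodule.subset_span (by simp)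
  have hbF : algebraMap D K b ∈ F := Submodule.subset_span (by simp)
  have hF0 : F ≠ ⊥ := by
    intro hbot
    rw [hbot, Submodule.mem_bot] at haF
    exact ha0 ((map_eq_zero_iff _ (IsFractionRing.injective D K)).mp haF)
  -- For `u ∈ F⁻¹` put `p = ua`, `q = ub`. Then `pb = aq`, so `p ∉ M` or `q ∉ M` would give one of
  -- the excluded divisibilities. Thus `FF⁻¹ ⊆ M`, against `1 ∈ (FF⁻¹)^{⋆_f}`.
  have hle : F * (1 / F) ≤ coeSubmodule K M := by
    rw [Submodule.mul_le]
    intro f hf u hu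
    rw [Submodule.mem_div_iff_forall_mul_mem] at hu
    obtain ⟨p, hp⟩ := Submodule.mem_one.mp (hu _ haF)
    obtain ⟨q, hq⟩ := Submodule.mem_one.mp (hu _ hbF)
    have hpq : p * b = a * q := by
      apply IsFractionRing.injective D K
      rw [map_mul, map_mul, hp, hq]
      ring
    have hpM : p ∈ M := by
      by_contra hpM
      exact (hcon p hpM).1 ⟨q, hpq⟩
    have hqM : q ∈ M := by
      by_contra hqM
      exact (hcon q hqM).2 ⟨p, by rw [mul_comm b, hpq, mul_comm]⟩
    obtain ⟨r, t, rfl⟩ := Submodule.mem_span_pair.mp hf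
    refine ⟨r * p + t * q, M.add_mem (M.mul_mem_left _ hpM) (M.mul_mem_left _ hqM), ?_⟩
    change algebraMap D K _ = _
    rw [map_add, map_mul, map_mul, hp, hq, Algebra.smul_def, Algebra.smul_def]
    ring
  have h1 : (1 : K) ∈ σ.finiteType (coeSubmodule K M) := by
    refine σ.finiteType.mono' _ _ hle ?_
    rw [h F (Submodule.fg_span (Set.toFinite _)) hF0]
    exact σ.finiteType.le_self' _ (Submodule.mem_one.mpr ⟨1, map_one _⟩)
  have hMq : σ.finiteType.quasiClosure M = M := hM.prop.1.2
  refine h1M (hMq ▸ ?_)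
  rwa [mem_quasiClosure, map_one]

/-- By the valuation property, either `y ∈ D_M` or `dy = s` with `s ∉ M`. In the second case `d ∈ M`
would force `s ∈ dD^⋆ ∩ D ⊆ M`, so `y = s/d` is again in `D_M`. -/
theorem IsPSMD.one_le_locAt {σ : SemistarOperation D K} (h : σ.IsPSMD) {M : Ideal D}
    (hM : σ.finiteType.IsQuasiMaximal M) {y : K} (hy : y ∈ σ 1) : y ∈ locAt K M hM.isPrime := by
  rw [mem_locAt_iff]
  obtain ⟨b, c, hc, hbc⟩ := IsFractionRing.div_surjective (A := D) y
  have hc' : algebraMap D K c ≠ 0 := IsFractionRing.to_map_ne_zero_of_mem_nonZeroDivisors hc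
  have hb : algebraMap D K b = algebraMap D K c * y := by rw [← hbc, mul_div_cancel₀ _ hc']
  obtain ⟨s, hs, ⟨d, hd⟩ | ⟨d, hd⟩⟩ := h.dvd_or_dvd hM c b
  · refine ⟨s, hs, d, mul_left_cancel₀ hc' ?_⟩
    rw [← map_mul, ← hd, map_mul, hb]
    ring
  · have hsd : algebraMap D K s = algebraMap D K d * y := by
      refine mul_left_cancel₀ hc' ?_
      rw [mul_comm, ← map_mul, hd, map_mul, hb]
      ring
    exact ⟨d, fun hdM => hs (hM.mem_of_eq_mul hdM hy hsd), s, hsd.symm⟩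

theorem mul_mem_one (σ : SemistarOperation D K) {y : K} {d : D} (hy : y ∈ σ 1) :
    y * algebraMap D K d ∈ σ 1 := by
  rw [mul_comm, ← Algebra.smul_def]
  exact Submodule.smul_mem _ d hy

/-! ### The contraction `aD_M ∩ D` is not idempotent -/

/-- Finitely many elements of `(aD_P ∩ D)²` have a common denominator outside `P`. -/
theorem exists_smul_le_of_le_sq {P : Ideal D} (hP : P.IsPrime) (a : D) {F : Submodule D K}
    (hF : F.FG) (hle : F ≤ coeSubmodule K (contraction P hP a) ^ 2) :
    ∃ s, s ∉ P ∧ ∀ x ∈ F, ∃ d, algebraMap D K s * x = algebraMap D K (a ^ 2 * d) := by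
  induction F, hF using Submodule.fg_induction with
  | singleton x =>
    replace hle := hle (Submodule.mem_span_singleton_self x)
    have key : ∃ s, s ∉ P ∧ ∃ d, algebraMap D K s * x = algebraMap D K (a ^ 2 * d) := by
      rw [pow_two] at hle
      induction hle using Submodule.mul_induction_on' with
      | mem_mul_mem m hm n hn =>
        obtain ⟨m, ⟨s, hs, c, hc⟩, rfl⟩ := hm
        obtain ⟨n, ⟨t, ht, e, he⟩, rfl⟩ := hn
        refine ⟨s * t, hP.mul_notMem hs ht, c * e, ?_⟩
        change _ * (algebraMap D K m * algebraMap D K n) = _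
        rw [← map_mul, ← map_mul, mul_mul_mul_comm, hc, he]
        congr 1
        ring
      | add x _ y _ hx hy =>
        obtain ⟨s, hs, c, hc⟩ := hx
        obtain ⟨t, ht, d, hd⟩ := hy
        exact ⟨s * t, hP.mul_notMem hs ht, _, common_denominator_add hc hd⟩
    obtain ⟨s, hs, d, hd⟩ := key
    refine ⟨s, hs, fun y hy => ?_⟩
    obtain ⟨r, rfl⟩ := Submodule.mem_span_singleton.mp hy
    refine ⟨r * d, ?_⟩
    rw [Algebra.smul_def, mul_left_comm, hd, ← map_mul, mul_left_comm]
  | sup F₁ F₂ _ _ h₁ h₂ =>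
    obtain ⟨s, hs, h₁⟩ := h₁ (le_sup_left.trans hle)
    obtain ⟨t, ht, h₂⟩ := h₂ (le_sup_right.trans hle)
    refine ⟨s * t, hP.mul_notMem hs ht, fun x hx => ?_⟩
    obtain ⟨y, hy, z, hz, rfl⟩ := Submodule.mem_sup.mp hx
    obtain ⟨c, hc⟩ := h₁ y hy
    obtain ⟨d, hd⟩ := h₂ z hz
    exact ⟨_, common_denominator_add hc hd⟩

/-- Idempotence puts `a` in `F^⋆` for a finitely generated `F ⊆ I²`. One `s ∉ M` satisfies `sF ⊆
a²D`, so `sa ∈ a²D^⋆`; cancelling `a` gives `s ∈ aD^⋆ ∩ D ⊆ M`. -/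
theorem IsQuasiMaximal.not_isIdempotent_contraction {σ : SemistarOperation D K} {M : Ideal D}
    (hM : σ.finiteType.IsQuasiMaximal M) {a : D} (ha : a ∈ M) (ha0 : a ≠ 0) :
    ¬ σ.finiteType.IsIdempotent (coeSubmodule K (contraction M hM.isPrime a)) := by
  intro h
  have haI : algebraMap D K a ∈ σ.finiteType (coeSubmodule K (contraction M hM.isPrime a)) :=
    σ.finiteType.le_self' _ ⟨a, self_mem_contraction M hM.isPrime a, rfl⟩
  rw [h] at haI
  obtain ⟨F, hF, hle, haF⟩ := haI
  obtain ⟨s, hs, hsF⟩ := exists_smul_le_of_le_sq hM.isPrime a hF hle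
  have ha' : algebraMap D K a ≠ 0 :=
    fun h => ha0 ((map_eq_zero_iff _ (IsFractionRing.injective D K)).mp h)
  have ha2 : algebraMap D K a ^ 2 ≠ 0 := pow_ne_zero 2 ha'
  have hs0 : algebraMap D K s ≠ 0 := fun h =>
    hs ((map_eq_zero_iff _ (IsFractionRing.injective D K)).mp h ▸ M.zero_mem)
  have hsub : algebraMap D K s • F ≤ algebraMap D K a ^ 2 • (1 : Submodule D K) := by
    rintro _ ⟨x, hx, rfl⟩
    obtain ⟨d, hd⟩ := hsF x hx
    refine ⟨algebraMap D K d, Submodule.mem_one.mpr ⟨d, rfl⟩, ?_⟩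
    change algebraMap D K a ^ 2 * algebraMap D K d = algebraMap D K s * x
    rw [hd, map_mul, map_pow]
  have hmem := σ.mono' _ _ hsub (by
    rw [σ.map_smul' _ _ hs0]
    exact Submodule.smul_mem_pointwise_smul _ _ _ haF)
  rw [σ.map_smul' _ _ ha2] at hmem
  obtain ⟨y, hy, hya⟩ := hmem
  refine hs (hM.mem_of_eq_mul ha hy (mul_right_cancel₀ ha' ?_))
  change algebraMap D K a ^ 2 * y = algebraMap D K s * algebraMap D K a at hya
  rw [← hya]
  ring

/-! ### Branched quasi-maximal ideals are sharp -/

theorem IsPSMD.isSharp_of_isBranched {σ : SemistarOperation D K} (h : σ.IsPSMD)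
    (hid : ∀ I : Ideal D, I ≠ ⊥ → σ 1 / coeSubmodule K I = σ 1 →
      σ.finiteType.IsIdempotent (coeSubmodule K I))
    {M : Ideal D} (hM : σ.finiteType.IsQuasiMaximal M) (hbr : M.IsBranched) :
    σ.finiteType.IsSharp M hM.isPrime := by
  intro hsharp
  obtain ⟨Q, hQ, rfl, hne⟩ := hbr
  obtain ⟨a, haM, haQ⟩ := SetLike.exists_of_lt (lt_of_le_of_ne Ideal.le_radical hne)
  have ha0 : a ≠ 0 := fun h => haQ (h ▸ Q.zero_mem)
  have hQI : Q ≤ contraction Q.radical hM.isPrime a := by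
    intro q hq
    obtain ⟨s, hs, hd | hd⟩ := h.dvd_or_dvd hM a q
    · exact ⟨s, hs, hd⟩
    · have hsa : s * a ∈ Q := Q.mem_of_dvd hd hq
      exact ((Ideal.isPrimary_iff.mp hQ).2 (mul_comm s a ▸ hsa)).elim (absurd · haQ) (absurd · hs)
  refine hM.not_isIdempotent_contraction haM ha0 (hid _ ?_ (le_antisymm ?_ ?_))
  · intro hbot
    have := self_mem_contraction Q.radical hM.isPrime a
    rw [hbot] at this
    exact ha0 this
  · intro x hx
    rw [Submodule.mem_div_iff_forall_mul_mem] at hx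
    have hN : ∀ (N : Ideal D) (hN : σ.finiteType.IsQuasiMaximal N), ¬ Q.radical ≤ N →
        x ∈ locAt K N hN.isPrime := by
      intro N hN hQN
      -- A prime not containing `rad Q` misses some `q ∈ Q ⊆ I`; then `xq ∈ D^⋆ ⊆ D_N`, where `q` is
      -- a unit.
      obtain ⟨q, hq, hqN⟩ := SetLike.not_le_iff_exists.mp
        fun hle : Q ≤ N => hQN (hN.isPrime.radical_le_iff.mpr hle)
      obtain ⟨s, hs, d, hd⟩ := mem_locAt_iff.mp
        (h.one_le_locAt hN (hx _ ⟨q, hQI hq, rfl⟩))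
      refine mem_locAt_iff.mpr ⟨s * q, hN.isPrime.mul_notMem hs hqN, d, ?_⟩
      rw [← hd, map_mul, Algebra.linearMap_apply]
      ring
    have hxθ : x ∈ σ.finiteType.theta Q.radical := by
      simp only [theta, Algebra.mem_iInf]
      exact hN
    refine σ.mem_one_of_forall_mem_locAt fun N hNq => ?_
    by_cases hle : Q.radical ≤ N
    · obtain rfl : Q.radical = N := hM.eq_of_le hNq.prop hle
      exact hsharp hxθ
    · exact hN N hNq hle
  · intro x hx
    rw [Submodule.mem_div_iff_forall_mul_mem]
    rintro _ ⟨d, -, rfl⟩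
    exact σ.mul_mem_one hx

/-! ### Specialization to the `v`- and `t`-operations -/

theorem tOp_one : tOp D K 1 = 1 := le_antisymm tOp_one_le ((tOp D K).le_self' 1)

theorem vOp_one : vOp D K 1 = 1 := by
  rw [← finiteType_one]
  exact tOp_one

theorem IsPvMD.isPSMD (h : IsPvMD D K) : (vOp D K).IsPSMD :=
  fun F hF hF0 => (h F hF hF0).trans tOp_one.symm

end SemistarOperation

theorem mainTheorem9 {D K : Type*} [CommRing D] [IsDomain D] [Field K] [Algebra D K]
    [IsFractionRing D K] :
    (∀ σ : SemistarOperation D K, σ.IsPSMD →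
      (∀ I : Ideal D, I ≠ ⊥ → σ 1 / coeSubmodule K I = σ 1 →
        σ.finiteType.IsIdempotent (coeSubmodule K I)) →
      ∀ (M : Ideal D) (hM : σ.finiteType.IsQuasiMaximal M), M.IsBranched →
        σ.finiteType.IsSharp M hM.isPrime) ∧
    (SemistarOperation.IsPvMD D K →
      (∀ I : Ideal D, I ≠ ⊥ → (1 : Submodule D K) / coeSubmodule K I = 1 →
        (SemistarOperation.tOp D K).IsIdempotent (coeSubmodule K I)) →
      ∀ (M : Ideal D) (hM : SemistarOperation.IsMaximalTIdeal K M), M.IsBranched →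
        (SemistarOperation.tOp D K).IsSharp M hM.isPrime) := by
  refine ⟨fun σ h hid M hM hbr => h.isSharp_of_isBranched hid hM hbr, fun h hid M hM hbr => ?_⟩
  refine h.isPSMD.isSharp_of_isBranched (fun I hI hI1 => hid I hI ?_)
    ((SemistarOperation.isMaximalTIdeal_iff M).mp hM) hbr
  rwa [SemistarOperation.vOp_one] at hI1
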